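/- For integers $r\ge 3$ and $n\ge 1$ put $$f_{r0r}(n):=\sum_{i=0}^{\lfloor n/r\rfloor-1}\ \sum_{j=0}^{i}\binom{i}{j}\binom{n-(i+1)r}{\lfloor (n-r)/2\rfloor-jr},$$ where $\binom{a}{b}$ is taken to be $0$ unless $0\le b\le a$ (so $f_{r0r}(n)=0$ for $n<r$, the sum being empty). A subset $X$ of a lattice $L$ is a generating set of $L$ if every subset of $L$ that contains $X$ and is closed under binary joins and meets equals $L$; $L^k$ is the $k$-th direct power, with componentwise operations. Let $r\ge 3$ and $k\ge 2$ be integers. Then there is a least positive integer $n$ with $k\le f_{r0r}(n)$, and for this $n$ the following holds: for every distributive lattice $D$ generated by $r$ (not necessarily distinct) elements, the direct power $D^k$ has a generating set with at most $n$ elements. -/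

import Mathlib

/-- The binomial coefficient of two integers, with the convention that it is `0` unless
`0 ≤ b ≤ a`. -/
def intBinom (a b : ℤ) : ℕ :=
  if 0 ≤ b ∧ b ≤ a then a.toNat.choose b.toNat else 0

/-- The function
`∑_{i=0}^{⌊n/r⌋-1} ∑_{j=0}^{i} C(i,j) * C(n-(i+1)r, p + ⌊(n-r)/2⌋ - j*r)`
(integer division by `2` is rounding down; the outer sum is empty for `n < r`). -/
def lowerEstimateShift (p : ℤ) (r n : ℕ) : ℕ :=
  ∑ i ∈ Finset.range (n / r), ∑ j ∈ Finset.range (i + 1),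
    i.choose j *
      intBinom ((n : ℤ) - ((i : ℤ) + 1) * (r : ℤ)) (p + ((n : ℤ) - (r : ℤ)) / 2 - (j : ℤ) * (r : ℤ))

/-- The function `f_{r0r}`, the case `p = 0`. -/
def lowerEstimate (r n : ℕ) : ℕ := lowerEstimateShift 0 r n

/-- `X` generates the lattice `L`: every subset of `L` that contains `X` and is closed under
binary joins and meets is all of `L`. -/
def IsGeneratingSet {L : Type*} [Lattice L] (X : Set L) : Prop :=
  ∀ Y : Set L, X ⊆ Y → IsSublattice Y → Y = Set.univ

/-! Each coordinate `s` gets an active block of `r` numbers below `n` and a set `A s` disjoint from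
it. The generator `y x` has value `⊤` at `s` if `x ∈ A s`, value `g p` if `x` is the `p`-th element
of the active block, and `⊥` otherwise. Every projection of the generated sublattice is then onto,
so it suffices to separate coordinates by `⊤` and `⊥` (`IsSublattice.eq_univ_of_separating`). The
join over `p` of the meets of `y` over `A s` with the `p`-th block element added does this under a
containment condition (`exists_generatingSet_pi`).

The condition holds when all `A s` have one common size and treat each earlier block as a unit
(`block_subset_or_not_subset`). Counting such configurations of size `(n - r) / 2` gives exactly
`lowerEstimate r n`, so `k` coordinates fit as soon as `k` is at most this number. -/

/-- A sublattice of a power of a bounded lattice that projects onto every factor and separates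
any two coordinates by an element that is `⊤` at the first and `⊥` at the second is the
whole power. -/
theorem IsSublattice.eq_univ_of_separating {ι D : Type*} [Fintype ι] [Nonempty ι] [Lattice D]
    [BoundedOrder D] {Y : Set (ι → D)} (hY : IsSublattice Y)
    (hproj : ∀ s d, ∃ u ∈ Y, u s = d)
    (hsep : ∀ s t, s ≠ t → ∃ w ∈ Y, w s = ⊤ ∧ w t = ⊥) : Y = Set.univ := by
  classical
  have hchar : ∀ s, ∃ e ∈ Y, e s = ⊤ ∧ ∀ t, s ≠ t → e t = ⊥ := by
    intro s
    have h : ∀ t, ∃ w ∈ Y, w s = ⊤ ∧ (s ≠ t → w t = ⊥) := by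
      intro t
      by_cases hst : s = t
      · obtain ⟨u, hu, hus⟩ := hproj s ⊤
        exact ⟨u, hu, hus, fun h => absurd hst h⟩
      · obtain ⟨w, hw, h1, h2⟩ := hsep s t hst
        exact ⟨w, hw, h1, fun _ => h2⟩
    choose w hw hs ht using h
    refine ⟨Finset.univ.inf' Finset.univ_nonempty w,
      hY.infClosed.finsetInf'_mem _ fun t _ => hw t, ?_, fun t hst => ?_⟩
    · rw [Finset.inf'_apply]
      exact top_le_iff.1 (Finset.le_inf' _ _ fun t _ => (hs t).ge)
    · rw [Finset.inf'_apply]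
      exact le_bot_iff.1 ((Finset.inf'_le _ (Finset.mem_univ t)).trans (ht t hst).le)
  choose e he hes het using hchar
  refine Set.eq_univ_of_forall fun d => ?_
  choose u hu hus using fun s => hproj s (d s)
  -- Meeting with `e s` keeps the value `d s` at `s` and puts `⊥` everywhere else.
  have hd : d = Finset.univ.sup' Finset.univ_nonempty fun s => u s ⊓ e s := by
    funext t
    rw [Finset.sup'_apply]
    apply le_antisymm
    · refine le_trans ?_ (Finset.le_sup' _ (Finset.mem_univ t))
      simp [hus, hes]
    · refine Finset.sup'_le _ _ fun s _ => ?_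
      by_cases hst : s = t
      · subst hst
        simp [hus]
      · simp [het s t hst]
  rw [hd]
  exact hY.supClosed.finsetSup'_mem _ fun s _ => hY.infClosed (hu s) (he s)

/-- The join of finitely many generators of a lattice is its largest element. -/
theorem IsGeneratingSet.le_sup' {ι D : Type*} [Fintype ι] [Nonempty ι] [Lattice D] {g : ι → D}
    (hg : IsGeneratingSet (Set.range g)) (d : D) :
    d ≤ Finset.univ.sup' Finset.univ_nonempty g := by
  have h := hg {d | d ≤ Finset.univ.sup' Finset.univ_nonempty g}
    (by rintro _ ⟨p, rfl⟩; exact Finset.le_sup' g (Finset.mem_univ p))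
    ⟨fun a ha b hb => sup_le ha hb, fun a ha b _ => inf_le_left.trans ha⟩
  exact h.ge (Set.mem_univ d)

/-- The meet of finitely many generators of a lattice is its least element. -/
theorem IsGeneratingSet.inf'_le {ι D : Type*} [Fintype ι] [Nonempty ι] [Lattice D] {g : ι → D}
    (hg : IsGeneratingSet (Set.range g)) (d : D) :
    Finset.univ.inf' Finset.univ_nonempty g ≤ d := by
  have h := hg {d | Finset.univ.inf' Finset.univ_nonempty g ≤ d}
    (by rintro _ ⟨p, rfl⟩; exact Finset.inf'_le g (Finset.mem_univ p))
    ⟨fun a ha b _ => ha.trans le_sup_left, fun a ha b hb => le_inf ha hb⟩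
  exact h.ge (Set.mem_univ d)

/-! ### Blocks and the separation condition -/

/-- The `i`-th block of `r` consecutive natural numbers. -/
def block (r i : ℕ) : Finset ℕ := Finset.Ico (i * r) (i * r + r)

theorem mem_block {r i x : ℕ} : x ∈ block r i ↔ i * r ≤ x ∧ x < i * r + r := Finset.mem_Ico

theorem card_block (r i : ℕ) : (block r i).card = r := by simp [block]

theorem block_disjoint {r i j : ℕ} (h : i < j) : Disjoint (block r i) (block r j) := by
  rw [Finset.disjoint_left]
  intro x hx hx'
  rw [mem_block] at hx hx'
  have : (i + 1) * r ≤ j * r := Nat.mul_le_mul_right r h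
  rw [Nat.succ_mul] at this
  omega

/-- Suppose that every `s` comes with a block and a set `A s` of elements outside this block, and
that for `s ≠ t` the sets `A s ∪ {x}`, `x` in the block of `s`, either contain the block of `t` or
are not contained in the union of `A t` and this block. Then the power indexed by the `s` of a
lattice with `r` generators has a generating set of at most `n` elements. -/
theorem exists_generatingSet_pi {ι : Type*} [Fintype ι] [Nonempty ι] {r n : ℕ} [NeZero r]
    (b : ι → ℕ) (A : ι → Finset ℕ) (hb : ∀ s, block r (b s) ⊆ Finset.range n)
    (hA : ∀ s, A s ⊆ Finset.range n) (hdisj : ∀ s, Disjoint (A s) (block r (b s)))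
    (hsep : ∀ s t, s ≠ t → ∀ x ∈ block r (b s),
      block r (b t) ⊆ insert x (A s) ∨ ¬ insert x (A s) ⊆ A t ∪ block r (b t))
    {D : Type*} [Lattice D] (g : Fin r → D) (hg : IsGeneratingSet (Set.range g)) :
    ∃ Y : Finset (ι → D), Y.card ≤ n ∧ IsGeneratingSet (Y : Set (ι → D)) := by
  classical
  let _ : BoundedOrder D :=
    { top := Finset.univ.sup' Finset.univ_nonempty g
      le_top := hg.le_sup'
      bot := Finset.univ.inf' Finset.univ_nonempty g
      bot_le := hg.inf'_le }
  let y : ℕ → ι → D := fun x s =>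
    if x ∈ A s then ⊤
    else if h : b s * r ≤ x ∧ x < b s * r + r then g ⟨x - b s * r, by omega⟩ else ⊥
  have hmem : ∀ s (p : Fin r), b s * r + p ∈ block r (b s) := fun s p =>
    mem_block.2 ⟨Nat.le_add_right _ _, Nat.add_lt_add_left p.2 _⟩
  have hyA : ∀ s x, x ∈ A s → y x s = ⊤ := fun s x hx => if_pos hx
  have hyb : ∀ s (p : Fin r), y (b s * r + p) s = g p := by
    intro s p
    have h1 : b s * r + p ∉ A s := fun h => Finset.disjoint_left.1 (hdisj s) h (hmem s p)
    have h2 := mem_block.1 (hmem s p)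
    simp only [y, if_neg h1, dif_pos h2, Nat.add_sub_cancel_left]
  have hy0 : ∀ s x, x ∉ A s ∪ block r (b s) → y x s = ⊥ := by
    intro s x hx
    rw [Finset.mem_union, not_or, mem_block] at hx
    simp only [y, if_neg hx.1, dif_neg hx.2]
  refine ⟨(Finset.range n).image y, Finset.card_image_le.trans (Finset.card_range n).le, ?_⟩
  intro Y hXY hY
  have hyY : ∀ x ∈ Finset.range n, y x ∈ Y := fun x hx =>
    hXY (Finset.mem_coe.2 (Finset.mem_image_of_mem y hx))
  refine hY.eq_univ_of_separating (fun s d => ?_) (fun s t hst => ?_)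
  · have h := hg {d | ∃ u ∈ Y, u s = d} ?_ ⟨?_, ?_⟩
    · exact h.ge (Set.mem_univ d)
    · rintro _ ⟨p, rfl⟩
      exact ⟨_, hyY _ (hb s (hmem s p)), hyb s p⟩
    · rintro _ ⟨u, hu, rfl⟩ _ ⟨v, hv, rfl⟩
      exact ⟨u ⊔ v, hY.supClosed hu hv, rfl⟩
    · rintro _ ⟨u, hu, rfl⟩ _ ⟨v, hv, rfl⟩
      exact ⟨u ⊓ v, hY.infClosed hu hv, rfl⟩
  -- At `s` the `p`-th meet is at least `g p`, and the `g p` join to `⊤`. At `t` each meet either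
  -- runs through all of `g`, whose meet is `⊥`, or has a factor `⊥`.
  · refine ⟨Finset.univ.sup' Finset.univ_nonempty fun p : Fin r =>
      (insert (b s * r + (p : ℕ)) (A s)).inf' (Finset.insert_nonempty _ _) y, ?_, ?_, ?_⟩
    · refine hY.supClosed.finsetSup'_mem _ fun p _ => hY.infClosed.finsetInf'_mem _ fun x hx => ?_
      rcases Finset.mem_insert.1 hx with rfl | hx
      · exact hyY _ (hb s (hmem s p))
      · exact hyY _ (hA s hx)
    · rw [Finset.sup'_apply]
      refine top_le_iff.1 (Finset.sup'_mono_fun (f := g) fun p _ => ?_)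
      rw [Finset.inf'_apply]
      refine Finset.le_inf' _ _ fun x hx => ?_
      rcases Finset.mem_insert.1 hx with rfl | hx
      · exact (hyb s p).ge
      · rw [hyA s x hx]
        exact le_top
    · rw [Finset.sup'_apply]
      refine le_bot_iff.1 (Finset.sup'_le _ _ fun p _ => ?_)
      rw [Finset.inf'_apply]
      rcases hsep s t hst _ (hmem s p) with h | h
      · refine Finset.le_inf' _ g fun q _ => ?_
        exact (Finset.inf'_le _ (h (hmem t q))).trans (hyb t q).le
      · obtain ⟨x, hx, hx'⟩ := Finset.not_subset.1 h
        exact (Finset.inf'_le _ hx).trans (hy0 t x hx').le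

/-- Sets of a common size, each of which avoids its own block and contains or avoids every earlier
block, satisfy the separation condition of `exists_generatingSet_pi`. -/
theorem block_subset_or_not_subset {r h b b' : ℕ} {A A' : Finset ℕ} (hA : A.card = h)
    (hA' : A'.card = h) (hd : Disjoint A (block r b)) (hd' : Disjoint A' (block r b'))
    (hlt : ∀ i < b, block r i ⊆ A ∨ Disjoint (block r i) A)
    (hlt' : ∀ i < b', block r i ⊆ A' ∨ Disjoint (block r i) A')
    (hne : b = b' → A ≠ A') {x : ℕ} (hx : x ∈ block r b) :
    block r b' ⊆ insert x A ∨ ¬ insert x A ⊆ A' ∪ block r b' := by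
  rw [or_iff_not_imp_right, not_not]
  intro hsub
  have hAsub : A ⊆ A' ∪ block r b' := (Finset.subset_insert x A).trans hsub
  have hxA : x ∉ A := fun h => Finset.disjoint_left.1 hd h hx
  rcases lt_trichotomy b b' with hbb | rfl | hbb
  · have hxb' : x ∉ block r b' := Finset.disjoint_left.1 (block_disjoint hbb) hx
    have hxA' : x ∈ A' := by
      have := hsub (Finset.mem_insert_self x A)
      exact (Finset.mem_union.1 this).resolve_right hxb'
    have hfull : block r b ⊆ A' := (hlt' b hbb).resolve_right fun h =>
      Finset.disjoint_left.1 h hx hxA'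
    -- `A` and `(A' \ block r b) ∪ block r b'` have the same size
    have h1 : A ⊆ (A' \ block r b) ∪ block r b' := by
      intro z hz
      rcases Finset.mem_union.1 (hAsub hz) with h | h
      · exact Finset.mem_union_left _
          (Finset.mem_sdiff.2 ⟨h, fun h' => Finset.disjoint_left.1 hd hz h'⟩)
      · exact Finset.mem_union_right _ h
    -- Exchanging one block for another does not increase the size, so the inclusion `h1` is an
    -- equality.
    have h2 : ((A' \ block r b) ∪ block r b').card ≤ A.card := by
      refine (Finset.card_union_le _ _).trans ?_
      rw [Finset.card_sdiff_of_subset hfull, card_block, card_block, hA, hA']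
      have := Finset.card_le_card hfull
      rw [card_block] at this
      omega
    rw [Finset.eq_of_subset_of_card_le h1 h2]
    exact Finset.subset_union_right.trans (Finset.subset_insert _ _)
  · exfalso
    refine hne rfl (Finset.eq_of_subset_of_card_le (fun z hz => ?_) (hA'.trans hA.symm).le)
    exact (Finset.mem_union.1 (hAsub hz)).resolve_right (Finset.disjoint_left.1 hd hz)
  · rcases hlt b' hbb with h | h
    · exact h.trans (Finset.subset_insert _ _)
    · exfalso
      -- Impossible by size: the left side has `h + 1` elements.
      have h1 : insert x A ⊆ A' := by
        intro z hz
        refine (Finset.mem_union.1 (hsub hz)).resolve_right fun hzb => ?_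
        rcases Finset.mem_insert.1 hz with rfl | hzA
        · exact Finset.disjoint_left.1 (block_disjoint hbb) hzb hx
        · exact Finset.disjoint_left.1 h hzb hzA
      have := Finset.card_le_card h1
      rw [Finset.card_insert_of_notMem hxA] at this
      omega

/-! ### Counting the configurations -/

/-- Index set counted by `lowerEstimate r n`: a number `b` of an active block, a number `j`, a set
of `j` blocks before the active one, and a subset of the elements after the active block. -/
def copyIndex (r n : ℕ) : Finset (Σ _ : ℕ, Σ _ : ℕ, Finset ℕ × Finset ℕ) :=
  (Finset.range (n / r)).sigma fun b => (Finset.range (b + 1)).sigma fun j =>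
    Finset.powersetCard j (Finset.range b) ×ˢ
      ((Finset.Ico ((b + 1) * r) n).powerset.filter fun B => j * r + B.card = (n - r) / 2)

theorem card_filter_powerset {α : Type*} (s : Finset α) (a h : ℕ) :
    (s.powerset.filter fun B => a + B.card = h).card =
      intBinom (s.card : ℤ) ((h : ℤ) - (a : ℤ)) := by
  classical
  unfold intBinom
  by_cases hah : a ≤ h
  · have h1 : (s.powerset.filter fun B => a + B.card = h) = s.powersetCard (h - a) := by
      ext B
      simp only [Finset.mem_filter, Finset.mem_powerset, Finset.mem_powersetCard]
      refine and_congr_right fun _ => ?_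
      omega
    rw [h1, Finset.card_powersetCard]
    split_ifs with h2
    · congr 1
      omega
    · exact Nat.choose_eq_zero_of_lt (by omega)
  · rw [if_neg (by omega), Finset.card_eq_zero, Finset.filter_eq_empty_iff]
    intro B _
    omega

theorem card_copyIndex (r n : ℕ) : (copyIndex r n).card = lowerEstimate r n := by
  unfold copyIndex lowerEstimate lowerEstimateShift
  rw [Finset.card_sigma]
  refine Finset.sum_congr rfl fun b hb => ?_
  rw [Finset.card_sigma]
  refine Finset.sum_congr rfl fun j _ => ?_
  rw [Finset.card_product, Finset.card_powersetCard, Finset.card_range, card_filter_powerset,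
    Nat.card_Ico]
  have h1 : (b + 1) * r ≤ n :=
    (Nat.mul_le_mul_right r (Finset.mem_range.1 hb)).trans (Nat.div_mul_le_self n r)
  have h2 : r ≤ n := le_trans (by nlinarith) h1
  congr 2
  · rw [Nat.cast_sub h1]
    push_cast
    ring
  · push_cast [Nat.cast_sub h2]
    ring

/-- The union of the chosen blocks and the chosen remaining elements. -/
def copyBase (r : ℕ) (c : Σ _ : ℕ, Σ _ : ℕ, Finset ℕ × Finset ℕ) : Finset ℕ :=
  c.2.2.1.biUnion (block r) ∪ c.2.2.2

/-- Chosen blocks lie before the active block and the free elements after it, so earlier blocks are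
taken whole or not at all, and the sizes add up to `j * r + B.card`. -/
theorem copyBase_spec {r n : ℕ} {c : Σ _ : ℕ, Σ _ : ℕ, Finset ℕ × Finset ℕ}
    (hc : c ∈ copyIndex r n) :
    block r c.1 ⊆ Finset.range n ∧ copyBase r c ⊆ Finset.range n ∧
      Disjoint (copyBase r c) (block r c.1) ∧ (copyBase r c).card = (n - r) / 2 ∧
      ∀ i < c.1, block r i ⊆ copyBase r c ∨ Disjoint (block r i) (copyBase r c) := by
  obtain ⟨b, j, J, B⟩ := c
  simp only [copyIndex, Finset.mem_sigma, Finset.mem_product, Finset.mem_powersetCard,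
    Finset.mem_filter, Finset.mem_powerset, Finset.mem_range] at hc
  obtain ⟨hb, -, ⟨hJ, hJc⟩, hB, hBc⟩ := hc
  have hbn : b * r + r ≤ n := by
    rw [← Nat.succ_mul]
    exact (Nat.mul_le_mul_right r hb).trans (Nat.div_mul_le_self n r)
  have hBge : ∀ x ∈ B, b * r + r ≤ x ∧ x < n := fun x hx => by
    rw [← Nat.succ_mul]
    exact Finset.mem_Ico.1 (hB hx)
  have hJlt : ∀ i ∈ J, i < b := fun i hi => Finset.mem_range.1 (hJ hi)
  have hblt : ∀ i < b, ∀ x ∈ block r i, x < b * r := fun i hi x hx => by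
    have h1 : (i + 1) * r ≤ b * r := Nat.mul_le_mul_right r hi
    rw [Nat.succ_mul] at h1
    exact (mem_block.1 hx).2.trans_le h1
  have hmem : ∀ x, x ∈ copyBase r ⟨b, j, J, B⟩ ↔ (∃ i ∈ J, x ∈ block r i) ∨ x ∈ B := by
    intro x
    simp [copyBase]
  refine ⟨fun x hx => ?_, fun x hx => ?_, ?_, ?_, fun i hi => ?_⟩
  · exact Finset.mem_range.2 ((mem_block.1 hx).2.trans_le hbn)
  · rw [Finset.mem_range]
    rcases (hmem x).1 hx with ⟨i, hi, hx⟩ | hx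
    · have := hblt i (hJlt i hi) x hx
      omega
    · exact (hBge x hx).2
  · rw [Finset.disjoint_left]
    intro x hx hxb
    have hxb : b * r ≤ x ∧ x < b * r + r := mem_block.1 hxb
    rcases (hmem x).1 hx with ⟨i, hi, hx⟩ | hx
    · have := hblt i (hJlt i hi) x hx
      omega
    · have := hBge x hx
      omega
  · have hd : Disjoint (J.biUnion (block r)) B := by
      rw [Finset.disjoint_left]
      intro x hx hxB
      obtain ⟨i, hi, hx⟩ := Finset.mem_biUnion.1 hx
      have h1 := hblt i (hJlt i hi) x hx
      have h2 := hBge x hxB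
      omega
    have hp : (J : Set ℕ).PairwiseDisjoint (block r) := fun i _ i' _ hii =>
      hii.lt_or_gt.elim block_disjoint fun h => (block_disjoint h).symm
    change (J.biUnion (block r) ∪ B).card = _
    rw [Finset.card_union_of_disjoint hd, Finset.card_biUnion hp]
    simp only [card_block, Finset.sum_const, smul_eq_mul, hJc]
    exact hBc
  · by_cases hiJ : i ∈ J
    · exact Or.inl fun x hx => (hmem x).2 (Or.inl ⟨i, hiJ, hx⟩)
    · refine Or.inr (Finset.disjoint_left.2 fun x hx hxA => ?_)
      rcases (hmem x).1 hxA with ⟨i', hi', hx'⟩ | hxB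
      · rcases (show i ≠ i' from fun h => hiJ (h ▸ hi')).lt_or_gt with h | h
        · exact Finset.disjoint_left.1 (block_disjoint h) hx hx'
        · exact Finset.disjoint_left.1 (block_disjoint h) hx' hx
      · have h1 := hblt i hi x hx
        have h2 := hBge x hxB
        omega

/-- Once the active block is known, the union determines its parts: an earlier block was chosen iff
its left endpoint is present, and the free elements are those past the active block. -/
theorem copyBase_injOn {r n : ℕ} (hr : 0 < r) {c c' : Σ _ : ℕ, Σ _ : ℕ, Finset ℕ × Finset ℕ}
    (hc : c ∈ copyIndex r n) (hc' : c' ∈ copyIndex r n) (hb : c.1 = c'.1)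
    (h : copyBase r c = copyBase r c') : c = c' := by
  have key : ∀ {c : Σ _ : ℕ, Σ _ : ℕ, Finset ℕ × Finset ℕ}, c ∈ copyIndex r n →
      c.2.1 = c.2.2.1.card ∧
      c.2.2.1 = (Finset.range c.1).filter (fun i => i * r ∈ copyBase r c) ∧
      c.2.2.2 = (copyBase r c).filter (fun x => (c.1 + 1) * r ≤ x) := by
    rintro ⟨b, j, J, B⟩ hc
    simp only [copyIndex, Finset.mem_sigma, Finset.mem_product, Finset.mem_powersetCard,
      Finset.mem_filter, Finset.mem_powerset, Finset.mem_range] at hc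
    obtain ⟨hb, -, ⟨hJ, hJc⟩, hB, hBc⟩ := hc
    have hmem : ∀ x, x ∈ copyBase r ⟨b, j, J, B⟩ ↔ (∃ i ∈ J, x ∈ block r i) ∨ x ∈ B := by
      intro x
      simp [copyBase]
    refine ⟨hJc.symm, ?_, ?_⟩
    · ext i
      simp only [Finset.mem_filter, Finset.mem_range, hmem]
      constructor
      · exact fun hi => ⟨Finset.mem_range.1 (hJ hi),
          Or.inl ⟨i, hi, mem_block.2 ⟨le_rfl, Nat.lt_add_of_pos_right hr⟩⟩⟩
      · rintro ⟨hib, ⟨i', hi', hx⟩ | hx⟩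
        · have hx := mem_block.1 hx
          have h1 : i' ≤ i := Nat.le_of_mul_le_mul_right hx.1 hr
          have h2 : i < i' + 1 := Nat.lt_of_mul_lt_mul_right (a := r) (by
            rw [Nat.succ_mul]; exact hx.2)
          rwa [show i = i' by omega]
        · have h1 := (Finset.mem_Ico.1 (hB hx)).1
          have h2 := Nat.le_of_mul_le_mul_right h1 hr
          omega
    · ext x
      simp only [Finset.mem_filter, hmem]
      constructor
      · exact fun hx => ⟨Or.inr hx, (Finset.mem_Ico.1 (hB hx)).1⟩
      · rintro ⟨⟨i, hi, hx⟩ | hx, hge⟩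
        · have hx := (mem_block.1 hx).2
          have hi := Finset.mem_range.1 (hJ hi)
          rw [← Nat.succ_mul] at hx
          have h2 := Nat.lt_of_mul_lt_mul_right (hge.trans_lt hx)
          omega
        · exact hx
  obtain ⟨h1, h2, h3⟩ := key hc
  obtain ⟨h1', h2', h3'⟩ := key hc'
  rw [← hb, ← h] at h2' h3'
  obtain ⟨b, j, J, B⟩ := c
  obtain ⟨b', j', J', B'⟩ := c'
  dsimp only at *
  have hJ : J = J' := h2.trans h2'.symm
  have hB : B = B' := h3.trans h3'.symm
  subst hb hJ hB
  rw [h1, h1']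

/-- `lowerEstimate r` is unbounded. -/
theorem exists_le_lowerEstimate {r : ℕ} (hr : 0 < r) (k : ℕ) : ∃ m, k ≤ lowerEstimate r m := by
  -- Here the single term `i = j = 0` is the central binomial coefficient `(2 * k).choose k`, which
  -- is at least `k`.
  refine ⟨r + 2 * k, ?_⟩
  have h0 : 0 ∈ Finset.range ((r + 2 * k) / r) :=
    Finset.mem_range.2 (Nat.div_pos (Nat.le_add_right _ _) hr)
  unfold lowerEstimate lowerEstimateShift
  refine le_trans ?_ (Finset.single_le_sum (fun _ _ => Nat.zero_le _) h0)
  have h1 : (2 * k).choose k = intBinom (2 * k : ℕ) k := by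
    rw [intBinom, if_pos (by omega), Int.toNat_natCast, Int.toNat_natCast]
  have h2 : k ≤ (2 * k).choose k := by
    rcases Nat.eq_zero_or_pos k with rfl | hk
    · simp
    · calc k ≤ 2 * k := by omega
        _ = (2 * k).choose 1 := (Nat.choose_one_right _).symm
        _ ≤ (2 * k).choose (2 * k / 2) := Nat.choose_le_middle _ _
        _ = (2 * k).choose k := by rw [Nat.mul_div_cancel_left k two_pos]
  simp only [zero_add, Finset.range_one, Finset.sum_singleton, Nat.choose_self, one_mul]
  refine h2.trans_eq (h1.trans ?_)
  congr 1
  · push_cast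
    ring
  · push_cast
    rw [zero_mul, sub_zero]
    omega

theorem corollary5p2 (r k : ℕ) (hr : 3 ≤ r) (hk : 2 ≤ k) :
    ∃ n : ℕ, IsLeast {m : ℕ | 0 < m ∧ k ≤ lowerEstimate r m} n ∧
      ∀ (D : Type*) [DistribLattice D] (g : Fin r → D), IsGeneratingSet (Set.range g) →
        ∃ Y : Finset (Fin k → D), Y.card ≤ n ∧ IsGeneratingSet (Y : Set (Fin k → D)) := by
  classical
  have hex : ∃ m, 0 < m ∧ k ≤ lowerEstimate r m := by
    obtain ⟨m, hm⟩ := exists_le_lowerEstimate (show 0 < r by omega) k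
    refine ⟨m, Nat.pos_of_ne_zero ?_, hm⟩
    rintro rfl
    simp only [lowerEstimate, lowerEstimateShift, Nat.zero_div, Finset.range_zero,
      Finset.sum_empty] at hm
    omega
  refine ⟨Nat.find hex, ⟨Nat.find_spec hex, fun m hm => Nat.find_min' hex hm⟩, ?_⟩
  intro D _ g hg
  have hn := (Nat.find_spec hex).2
  rw [← card_copyIndex] at hn
  obtain ⟨T, hT, hTk⟩ := Finset.exists_subset_card_eq hn
  have : NeZero r := ⟨by omega⟩
  have : Nonempty (Fin k) := ⟨⟨0, by omega⟩⟩
  let c : Fin k → T := (T.equivFinOfCardEq hTk).symm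
  have hc : ∀ s, (c s : Σ _ : ℕ, Σ _ : ℕ, Finset ℕ × Finset ℕ) ∈ copyIndex r (Nat.find hex) :=
    fun s => hT (c s).2
  refine exists_generatingSet_pi (fun s => (c s).1.1) (fun s => copyBase r (c s).1)
    (fun s => (copyBase_spec (hc s)).1) (fun s => (copyBase_spec (hc s)).2.1)
    (fun s => (copyBase_spec (hc s)).2.2.1) (fun s t hst x hx => ?_) g hg
  obtain ⟨-, -, hd, hcard, hlt⟩ := copyBase_spec (hc s)
  obtain ⟨-, -, hd', hcard', hlt'⟩ := copyBase_spec (hc t)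
  refine block_subset_or_not_subset hcard hcard' hd hd' hlt hlt' (fun hb h => hst ?_) hx
  exact (T.equivFinOfCardEq hTk).symm.injective
    (Subtype.ext (copyBase_injOn (by omega) (hc s) (hc t) hb h))
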